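/- Let $\ell^2(\mathbb{Z}_+)$ have standard basis $\{e_n\}_{n\ge 0}$, let $T e_n=e_{n+1}$ be the right shift, and let $\mathcal{T}\subset\mathcal{B}(\ell^2(\mathbb{Z}_+))$ be the Toeplitz algebra, i.e. the norm closed algebra generated by $T$ and $T^*$. Put $T_{n,m}=T^nT^{*m}$ for $n,m\in\mathbb{Z}_+$. Let $\mathcal{T}\otimes\mathcal{T}$ be the minimal $C^*$-tensor product and let $\Delta\colon\mathcal{T}\to\mathcal{T}\otimes\mathcal{T}$ be the unique unital $*$-homomorphism with $\Delta(T)=T\otimes T$. For bounded linear functionals $\rho,\varphi\in\mathcal{T}^*$ let $\rho*\varphi=(\rho\otimes\varphi)\circ\Delta\in\mathcal{T}^*$. A state $h\in\mathcal{T}^*$ (a positive linear functional of norm one) is called a Haar functional if for every $\rho\in\mathcal{T}^*$ there is $\lambda_\rho\in\mathbb{C}$ with $h*\rho=\rho*h=\lambda_\rho h$. Theorem. A state $h$ on $\mathcal{T}$ is a Haar functional if and only if $h(T_{0,0})=1$ and $h(T_{n,m})=0$ for all $(n,m)\neq(0,0)$. A Haar functional exists, and every Haar functional $h$ is the vector state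 $h(A)=\langle Ae_0,e_0\rangle$, $A\in\mathcal{T}$. -/

import Mathlib

open scoped TensorProduct ENNReal ComplexOrder

noncomputable section

namespace QSemigroup

/-! ### The minimal (spatial) tensor product of two concrete C*-algebras -/

section Spatial

variable {H : Type*} [NormedAddCommGroup H] [InnerProductSpace ℂ H]
variable {K : Type*} [NormedAddCommGroup K] [InnerProductSpace ℂ K]

/-- The Hilbert space tensor product: the completion of the algebraic tensor product with respect
to the norm of the inner product `⟪x ⊗ y, x' ⊗ y'⟫ = ⟪x, x'⟫ ⟪y, y'⟫`. -/
def HilbertTensor (H K : Type*) [NormedAddCommGroup H] [InnerProductSpace ℂ H]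
    [NormedAddCommGroup K] [InnerProductSpace ℂ K] : Type _ :=
  UniformSpace.Completion (H ⊗[ℂ] K)

instance : NormedAddCommGroup (HilbertTensor H K) :=
  inferInstanceAs (NormedAddCommGroup (UniformSpace.Completion (H ⊗[ℂ] K)))

instance : InnerProductSpace ℂ (HilbertTensor H K) :=
  inferInstanceAs (InnerProductSpace ℂ (UniformSpace.Completion (H ⊗[ℂ] K)))

instance : CompleteSpace (HilbertTensor H K) :=
  inferInstanceAs (CompleteSpace (UniformSpace.Completion (H ⊗[ℂ] K)))

/-- The canonical isometric embedding of the algebraic tensor product. -/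
def ofAlg : (H ⊗[ℂ] K) →ₗᵢ[ℂ] HilbertTensor H K :=
  (UniformSpace.Completion.toComplₗᵢ : (H ⊗[ℂ] K) →ₗᵢ[ℂ] UniformSpace.Completion (H ⊗[ℂ] K))

/-- The elementary tensor `x ⊗ y` in the Hilbert space tensor product. -/
def vtmul (x : H) (y : K) : HilbertTensor H K := ofAlg (x ⊗ₜ[ℂ] y)

/-- The operator `A ⊗ B` on the Hilbert space tensor product, `(A ⊗ B) (x ⊗ y) = A x ⊗ B y`. -/
def opTensor (A : H →L[ℂ] H) (B : K →L[ℂ] K) : HilbertTensor H K →L[ℂ] HilbertTensor H K :=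
  (TensorProduct.mapL A B).completion

theorem dense_ofAlg : DenseRange (ofAlg : H ⊗[ℂ] K → HilbertTensor H K) :=
  UniformSpace.Completion.denseRange_coe

theorem opTensor_vtmul (A : H →L[ℂ] H) (B : K →L[ℂ] K) (x : H) (y : K) :
    opTensor A B (vtmul x y) = vtmul (A x) (B y) :=
  (TensorProduct.mapL A B).completion_apply_coe (x ⊗ₜ[ℂ] y)

theorem inner_vtmul (x x' : H) (y y' : K) :
    inner ℂ (vtmul x y) (vtmul x' y') = inner ℂ x x' * inner ℂ y y' := by
  simp [vtmul]

theorem norm_vtmul (x : H) (y : K) : ‖vtmul x y‖ = ‖x‖ * ‖y‖ := by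
  simp [vtmul]

theorem vtmul_add_left (x x' : H) (y : K) : vtmul (x + x') y = vtmul x y + vtmul x' y := by
  simp [vtmul, TensorProduct.add_tmul]

theorem vtmul_add_right (x : H) (y y' : K) : vtmul x (y + y') = vtmul x y + vtmul x y' := by
  simp [vtmul, TensorProduct.tmul_add]

theorem vtmul_smul_left (c : ℂ) (x : H) (y : K) : vtmul (c • x) y = c • vtmul x y := by
  rw [vtmul, vtmul, ← map_smul, TensorProduct.smul_tmul']

theorem vtmul_smul_right (c : ℂ) (x : H) (y : K) : vtmul x (c • y) = c • vtmul x y := by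
  rw [vtmul, vtmul, ← map_smul, TensorProduct.tmul_smul]

/-- The elementary tensors are total. -/
theorem dense_span_vtmul :
    (Submodule.span ℂ {v : HilbertTensor H K | ∃ x y, v = vtmul x y}).topologicalClosure = ⊤ := by
  rw [eq_top_iff]
  rintro v -
  refine dense_ofAlg.induction_on v (Submodule.isClosed_topologicalClosure _) ?_
  intro t
  refine Submodule.le_topologicalClosure _ ?_
  induction t with
  | zero => rw [map_zero]; exact Submodule.zero_mem _
  | tmul x y => exact Submodule.subset_span ⟨x, y, rfl⟩
  | add a b ha hb => rw [map_add]; exact Submodule.add_mem _ ha hb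

theorem clm_ext_vtmul {M : Type*} [NormedAddCommGroup M] [NormedSpace ℂ M]
    {f g : HilbertTensor H K →L[ℂ] M} (h : ∀ x y, f (vtmul x y) = g (vtmul x y)) : f = g := by
  refine ContinuousLinearMap.ext_on (s := {v : HilbertTensor H K | ∃ x y, v = vtmul x y}) ?_ ?_
  · intro v
    have := (dense_span_vtmul (H := H) (K := K)).ge (Submodule.mem_top (x := v))
    exact this
  · rintro v ⟨x, y, rfl⟩
    exact h x y

theorem opTensor_mul (A A' : H →L[ℂ] H) (B B' : K →L[ℂ] K) :
    opTensor (A * A') (B * B') = opTensor A B * opTensor A' B' :=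
  clm_ext_vtmul fun x y => by simp [opTensor_vtmul]

theorem opTensor_one : opTensor (1 : H →L[ℂ] H) (1 : K →L[ℂ] K) = 1 :=
  clm_ext_vtmul fun x y => by simp [opTensor_vtmul]

theorem opTensor_add_left (A A' : H →L[ℂ] H) (B : K →L[ℂ] K) :
    opTensor (A + A') B = opTensor A B + opTensor A' B :=
  clm_ext_vtmul fun x y => by simp [opTensor_vtmul, vtmul_add_left]

theorem opTensor_add_right (A : H →L[ℂ] H) (B B' : K →L[ℂ] K) :
    opTensor A (B + B') = opTensor A B + opTensor A B' :=
  clm_ext_vtmul fun x y => by simp [opTensor_vtmul, vtmul_add_right]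

theorem opTensor_smul_left (c : ℂ) (A : H →L[ℂ] H) (B : K →L[ℂ] K) :
    opTensor (c • A) B = c • opTensor A B :=
  clm_ext_vtmul fun x y => by simp [opTensor_vtmul, vtmul_smul_left]

theorem opTensor_smul_right (c : ℂ) (A : H →L[ℂ] H) (B : K →L[ℂ] K) :
    opTensor A (c • B) = c • opTensor A B :=
  clm_ext_vtmul fun x y => by simp [opTensor_vtmul, vtmul_smul_right]

theorem opTensor_star [CompleteSpace H] [CompleteSpace K] (A : H →L[ℂ] H) (B : K →L[ℂ] K) :
    star (opTensor A B) = opTensor (star A) (star B) := by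
  refine clm_ext_vtmul fun x y => ?_
  refine ext_inner_right ℂ fun v => ?_
  rw [ContinuousLinearMap.star_eq_adjoint, ContinuousLinearMap.adjoint_inner_left]
  have : (innerSL ℂ (vtmul x y)).comp (opTensor A B)
      = innerSL ℂ (opTensor (star A) (star B) (vtmul x y)) := by
    refine clm_ext_vtmul fun x' y' => ?_
    simp [opTensor_vtmul, inner_vtmul, ContinuousLinearMap.star_eq_adjoint,
      ContinuousLinearMap.adjoint_inner_left]
  simpa using congrArg (fun f => f v) this

theorem opNorm_le_of_inner {A : H →L[ℂ] H} {C : ℝ} (hC : 0 ≤ C)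
    (h : ∀ x y, ‖inner ℂ x (A y)‖ ≤ C * (‖x‖ * ‖y‖)) : ‖A‖ ≤ C := by
  refine ContinuousLinearMap.opNorm_le_bound _ hC fun y => ?_
  rcases (norm_nonneg (A y)).eq_or_lt with h0 | h0
  · rw [← h0]; positivity
  have h1 := h (A y) y
  rw [inner_self_eq_norm_sq_to_K, norm_pow, RCLike.norm_ofReal, abs_norm] at h1
  exact le_of_mul_le_mul_left (by linarith) h0

variable [CompleteSpace H] [CompleteSpace K]

/-- The minimal tensor product of two C*-algebras of operators on Hilbert spaces: the C*-algebra
of operators on the Hilbert space tensor product generated by the operators `A ⊗ B`. -/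
def minTensor (𝒜 : StarSubalgebra ℂ (H →L[ℂ] H)) (ℬ : StarSubalgebra ℂ (K →L[ℂ] K)) :
    StarSubalgebra ℂ (HilbertTensor H K →L[ℂ] HilbertTensor H K) :=
  (StarAlgebra.adjoin ℂ {u | ∃ A ∈ 𝒜, ∃ B ∈ ℬ, u = opTensor A B}).topologicalClosure

/-! Shortcut instances, for the speed of instance search only. -/

instance (S : StarSubalgebra ℂ (H →L[ℂ] H)) : NormedRing S := inferInstance
instance (S : StarSubalgebra ℂ (H →L[ℂ] H)) : NormedAddCommGroup S := inferInstance
instance (S : StarSubalgebra ℂ (H →L[ℂ] H)) : SeminormedAddCommGroup S := inferInstance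
instance (S : StarSubalgebra ℂ (H →L[ℂ] H)) : AddCommGroup S := inferInstance
instance (S : StarSubalgebra ℂ (H →L[ℂ] H)) : AddCommMonoid S := inferInstance
instance (S : StarSubalgebra ℂ (H →L[ℂ] H)) : NormedSpace ℂ S := inferInstance
instance (S : StarSubalgebra ℂ (H →L[ℂ] H)) : Module ℂ S := inferInstance

variable {𝒜 : StarSubalgebra ℂ (H →L[ℂ] H)} {ℬ : StarSubalgebra ℂ (K →L[ℂ] K)}

/-- The elementary tensor `A ⊗ B` as an element of the minimal tensor product. -/
def tmul (A : 𝒜) (B : ℬ) : minTensor 𝒜 ℬ :=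
  ⟨opTensor (A : H →L[ℂ] H) (B : K →L[ℂ] K),
    StarSubalgebra.le_topologicalClosure _
      (StarAlgebra.subset_adjoin ℂ _ ⟨A, A.2, B, B.2, rfl⟩)⟩

theorem isClosed_minTensor : IsClosed ((minTensor 𝒜 ℬ : StarSubalgebra ℂ _) :
    Set (HilbertTensor H K →L[ℂ] HilbertTensor H K)) :=
  StarSubalgebra.isClosed_topologicalClosure _

/-- The canonical map from the algebraic to the minimal tensor product. -/
def toMin (𝒜 : StarSubalgebra ℂ (H →L[ℂ] H)) (ℬ : StarSubalgebra ℂ (K →L[ℂ] K)) :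
    𝒜 ⊗[ℂ] ℬ →ₗ[ℂ] minTensor 𝒜 ℬ :=
  TensorProduct.lift <| LinearMap.mk₂ ℂ tmul
    (fun _ _ _ => Subtype.ext (opTensor_add_left _ _ _))
    (fun _ _ _ => Subtype.ext (opTensor_smul_left _ _ _))
    (fun _ _ _ => Subtype.ext (opTensor_add_right _ _ _))
    (fun _ _ _ => Subtype.ext (opTensor_smul_right _ _ _))

theorem toMin_tmul (A : 𝒜) (B : ℬ) : toMin 𝒜 ℬ (A ⊗ₜ[ℂ] B) = tmul A B := by
  simp [toMin]

/-- The linear combinations of elementary tensors are dense in the minimal tensor product. -/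
theorem dense_range_toMin : DenseRange (toMin 𝒜 ℬ) := by
  set S : Set (HilbertTensor H K →L[ℂ] HilbertTensor H K) :=
    {u | ∃ A ∈ 𝒜, ∃ B ∈ ℬ, u = opTensor A B} with hS
  have hstar : S ∪ star S = S := by
    refine Set.union_eq_left.2 ?_
    rintro u ⟨A, hA, B, hB, h⟩
    refine ⟨star A, star_mem hA, star B, star_mem hB, ?_⟩
    rw [← opTensor_star, ← h, star_star]
  let N : Submonoid (HilbertTensor H K →L[ℂ] HilbertTensor H K) :=
    { carrier := S
      one_mem' := ⟨1, one_mem _, 1, one_mem _, opTensor_one.symm⟩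
      mul_mem' := by
        rintro _ _ ⟨A, hA, B, hB, rfl⟩ ⟨A', hA', B', hB', rfl⟩
        exact ⟨A * A', mul_mem hA hA', B * B', mul_mem hB hB', (opTensor_mul _ _ _ _).symm⟩ }
  have hspan : ∀ u ∈ StarAlgebra.adjoin ℂ S, u ∈ Submodule.span ℂ S := by
    intro u hu
    have h1 : u ∈ Subalgebra.toSubmodule (Algebra.adjoin ℂ S) := by
      have h2 := StarAlgebra.adjoin_toSubalgebra ℂ S
      rw [hstar] at h2
      rw [← h2]
      exact hu
    have hN : Submonoid.closure S = N := Submonoid.closure_eq N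
    rw [Algebra.adjoin_eq_span, hN] at h1
    exact h1
  have hrange : ∀ u ∈ Submodule.span ℂ S, ∃ t, (toMin 𝒜 ℬ t : _ →L[ℂ] _) = u := by
    intro u hu
    induction hu using Submodule.span_induction with
    | mem u hu =>
      obtain ⟨A, hA, B, hB, rfl⟩ := hu
      exact ⟨(⟨A, hA⟩ : 𝒜) ⊗ₜ[ℂ] (⟨B, hB⟩ : ℬ), by rw [toMin_tmul]; rfl⟩
    | zero => exact ⟨0, by simp⟩
    | add u v _ _ hu hv =>
      obtain ⟨s, rfl⟩ := hu
      obtain ⟨t, rfl⟩ := hv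
      exact ⟨s + t, by simp⟩
    | smul c u _ hu =>
      obtain ⟨s, rfl⟩ := hu
      exact ⟨c • s, by simp⟩
  intro u
  rw [closure_subtype]
  refine closure_mono ?_ u.2
  intro v hv
  obtain ⟨t, rfl⟩ := hrange v (hspan v hv)
  exact ⟨_, ⟨t, rfl⟩, rfl⟩

/-- The functional `ρ ⊗ φ` on the algebraic tensor product. -/
def algFunctional (ρ : StrongDual ℂ 𝒜) (φ : StrongDual ℂ ℬ) : 𝒜 ⊗[ℂ] ℬ →ₗ[ℂ] ℂ :=
  TensorProduct.lift (((LinearMap.mul ℂ ℂ).compl₂ φ.toLinearMap).comp ρ.toLinearMap)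

theorem algFunctional_tmul (ρ : StrongDual ℂ 𝒜) (φ : StrongDual ℂ ℬ) (A : 𝒜) (B : ℬ) :
    algFunctional ρ φ (A ⊗ₜ[ℂ] B) = ρ A * φ B := by
  simp [algFunctional]

/-- The slice map `A ⊗ B ↦ ρ(A) B`. -/
def sliceL (ρ : 𝒜 →ₗ[ℂ] ℂ) : 𝒜 ⊗[ℂ] ℬ →ₗ[ℂ] ℬ :=
  (TensorProduct.lid ℂ ℬ).toLinearMap ∘ₗ LinearMap.rTensor ℬ ρ

/-- The slice map `A ⊗ B ↦ φ(B) A`. -/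
def sliceR (φ : ℬ →ₗ[ℂ] ℂ) : 𝒜 ⊗[ℂ] ℬ →ₗ[ℂ] 𝒜 :=
  (TensorProduct.rid ℂ 𝒜).toLinearMap ∘ₗ LinearMap.lTensor 𝒜 φ

/-- The matrix coefficient `B ↦ ⟪x, B y⟫`. -/
def coeff (ℬ : StarSubalgebra ℂ (K →L[ℂ] K)) (x y : K) : ℬ →ₗ[ℂ] ℂ where
  toFun B := inner ℂ x ((B : K →L[ℂ] K) y)
  map_add' := by intros; simp
  map_smul' := by intros; simp

theorem norm_sliceR_coeff (x y : K) (t : 𝒜 ⊗[ℂ] ℬ) :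
    ‖sliceR (coeff ℬ x y) t‖ ≤ ‖toMin 𝒜 ℬ t‖ * (‖x‖ * ‖y‖) := by
  change ‖(sliceR (coeff ℬ x y) t : H →L[ℂ] H)‖ ≤ _
  refine opNorm_le_of_inner (by positivity) fun p q => ?_
  have key : inner ℂ p ((sliceR (coeff ℬ x y) t : H →L[ℂ] H) q)
      = inner ℂ (vtmul p x) ((toMin 𝒜 ℬ t : _ →L[ℂ] _) (vtmul q y)) := by
    induction t with
    | zero => simp
    | tmul A B =>
      rw [toMin_tmul]
      simp [sliceR, coeff, tmul, opTensor_vtmul, inner_vtmul, mul_comm]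
    | add a b ha hb => simp [ha, hb]
  rw [key]
  calc _ ≤ ‖vtmul p x‖ * ‖(toMin 𝒜 ℬ t : _ →L[ℂ] _) (vtmul q y)‖ := norm_inner_le_norm _ _
    _ ≤ ‖vtmul p x‖ * (‖toMin 𝒜 ℬ t‖ * ‖vtmul q y‖) := by
        gcongr
        exact ContinuousLinearMap.le_opNorm _ _
    _ = _ := by rw [norm_vtmul, norm_vtmul]; ring

theorem norm_sliceL (ρ : StrongDual ℂ 𝒜) (t : 𝒜 ⊗[ℂ] ℬ) :
    ‖sliceL ρ.toLinearMap t‖ ≤ ‖ρ‖ * ‖toMin 𝒜 ℬ t‖ := by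
  change ‖(sliceL ρ.toLinearMap t : K →L[ℂ] K)‖ ≤ _
  refine opNorm_le_of_inner (by positivity) fun x y => ?_
  have key : inner ℂ x ((sliceL ρ.toLinearMap t : K →L[ℂ] K) y)
      = ρ (sliceR (coeff ℬ x y) t) := by
    induction t with
    | zero => simp
    | tmul A B => simp [sliceR, sliceL, coeff, mul_comm]
    | add a b ha hb => simp [ha, hb]
  rw [key]
  calc _ ≤ ‖ρ‖ * ‖sliceR (coeff ℬ x y) t‖ := ρ.le_opNorm _
    _ ≤ ‖ρ‖ * (‖toMin 𝒜 ℬ t‖ * (‖x‖ * ‖y‖)) := by gcongr; exact norm_sliceR_coeff x y t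
    _ = _ := by ring

theorem norm_algFunctional (ρ : StrongDual ℂ 𝒜) (φ : StrongDual ℂ ℬ) (t : 𝒜 ⊗[ℂ] ℬ) :
    ‖algFunctional ρ φ t‖ ≤ (‖ρ‖ * ‖φ‖) * ‖toMin 𝒜 ℬ t‖ := by
  have key : algFunctional ρ φ t = φ (sliceL ρ.toLinearMap t) := by
    induction t with
    | zero => simp
    | tmul A B => simp [sliceL, algFunctional_tmul]
    | add a b ha hb => simp [ha, hb]
  rw [key]
  calc _ ≤ ‖φ‖ * ‖sliceL ρ.toLinearMap t‖ := φ.le_opNorm _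
    _ ≤ ‖φ‖ * (‖ρ‖ * ‖toMin 𝒜 ℬ t‖) := by gcongr; exact norm_sliceL ρ t
    _ = _ := by ring

theorem existsUnique_extension {E F : Type*} [AddCommGroup E] [Module ℂ E]
    [NormedAddCommGroup F] [NormedSpace ℂ F] (f : E →ₗ[ℂ] ℂ) (e : E →ₗ[ℂ] F) (he : DenseRange e)
    (C : ℝ) (hC : ∀ t, ‖f t‖ ≤ C * ‖e t‖) : ∃! Φ : F →L[ℂ] ℂ, ∀ t, Φ (e t) = f t := by
  refine ⟨f.extendOfNorm e, fun t => LinearMap.extendOfNorm_eq he ⟨C, hC⟩ t, fun Ψ hΨ => ?_⟩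
  exact (LinearMap.extendOfNorm_unique he C hC Ψ (LinearMap.ext hΨ)).symm

/-- Bounded functionals `ρ`, `φ` have a unique bounded tensor product on the minimal tensor
product. -/
theorem existsUnique_tensorFunctional (ρ : StrongDual ℂ 𝒜) (φ : StrongDual ℂ ℬ) :
    ∃! Φ : StrongDual ℂ (minTensor 𝒜 ℬ), ∀ (A : 𝒜) (B : ℬ), Φ (tmul A B) = ρ A * φ B := by
  obtain ⟨Φ, h, hu⟩ := existsUnique_extension (algFunctional ρ φ) (toMin 𝒜 ℬ) dense_range_toMin _
    (norm_algFunctional ρ φ)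
  refine ⟨Φ, fun A B => ?_, fun Ψ hΨ => hu Ψ fun t => ?_⟩
  · rw [← toMin_tmul, h, algFunctional_tmul]
  · induction t with
    | zero => rw [map_zero, map_zero, map_zero]
    | tmul A B => rw [toMin_tmul, algFunctional_tmul, hΨ]
    | add a b ha hb => rw [map_add, map_add, map_add, ha, hb]

/-- The tensor product `ρ ⊗ φ` of bounded functionals: the bounded functional on the minimal
tensor product with `(ρ ⊗ φ) (A ⊗ B) = ρ(A) φ(B)`. -/
def tensorFunctional (ρ : StrongDual ℂ 𝒜) (φ : StrongDual ℂ ℬ) : StrongDual ℂ (minTensor 𝒜 ℬ) :=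
  (existsUnique_tensorFunctional ρ φ).choose

theorem tensorFunctional_tmul (ρ : StrongDual ℂ 𝒜) (φ : StrongDual ℂ ℬ) (A : 𝒜) (B : ℬ) :
    tensorFunctional ρ φ (tmul A B) = ρ A * φ B :=
  (existsUnique_tensorFunctional ρ φ).choose_spec.1 A B

end Spatial

/-! ### The Toeplitz algebra -/

/-- The Hilbert space `ℓ²` of square summable complex functions on the nonnegative integers. -/
abbrev L2 : Type := lp (fun _ : ℕ => ℂ) 2

/-- The standard basis vector `e n`. -/
def e (n : ℕ) : L2 := lp.single 2 n (1 : ℂ)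

/-- The sequence `(0, f 0, f 1, …)`. -/
def shiftFun (f : ℕ → ℂ) : ℕ → ℂ
  | 0 => 0
  | n + 1 => f n

theorem hasSum_shiftFun (f : L2) :
    HasSum (fun n => ‖shiftFun f n‖ ^ (2 : ℝ≥0∞).toReal) (‖f‖ ^ (2 : ℝ≥0∞).toReal) := by
  have h := lp.hasSum_norm (p := 2) (by norm_num) f
  rw [← hasSum_nat_add_iff' 1]
  simpa [shiftFun] using h

/-- The right shift `(f 0, f 1, …) ↦ (0, f 0, f 1, …)`, as an isometry. -/
def shiftIsometry : L2 →ₗᵢ[ℂ] L2 where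
  toFun f := ⟨shiftFun f, memℓp_gen (hasSum_shiftFun f).summable⟩
  map_add' f g := by
    ext n
    change shiftFun (f + g : L2) n = shiftFun f n + shiftFun g n
    cases n <;> simp [shiftFun]
  map_smul' c f := by
    ext n
    cases n <;> simp [shiftFun]
  norm_map' f := by
    have h1 := lp.hasSum_norm (p := 2) (by norm_num)
      (⟨shiftFun f, memℓp_gen (hasSum_shiftFun f).summable⟩ : L2)
    have h2 := h1.unique (hasSum_shiftFun f)
    exact (Real.rpow_left_inj (norm_nonneg _) (norm_nonneg _) (by norm_num)).1 h2

/-- The right shift operator `T`. -/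
def shift : L2 →L[ℂ] L2 := shiftIsometry.toContinuousLinearMap

theorem shift_e (n : ℕ) : shift (e n) = e (n + 1) := by
  ext m
  change shiftFun (e n) m = e (n + 1) m
  cases m <;> simp [shiftFun, e, Pi.single_apply]

/-- The Toeplitz algebra: the norm closed *-algebra generated by the right shift. -/
def Toeplitz : StarSubalgebra ℂ (L2 →L[ℂ] L2) := StarAlgebra.elemental ℂ shift

/-- The generator `T` of the Toeplitz algebra. -/
def T : Toeplitz := ⟨shift, StarAlgebra.elemental.self_mem ℂ shift⟩

/-- The operators `T_{n,m} = T ^ n T* ^ m`. -/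
def Tnm (n m : ℕ) : Toeplitz := T ^ n * star T ^ m

/-! ### The comultiplication -/

/-- The Hilbert basis `e n`. -/
def eBasis : HilbertBasis ℕ ℂ L2 := HilbertBasis.ofRepr (LinearIsometryEquiv.refl ℂ _)

theorem eBasis_apply (n : ℕ) : eBasis n = e n := by
  rw [← HilbertBasis.repr_symm_single]
  rfl

section Basis

variable {H : Type*} [NormedAddCommGroup H] [InnerProductSpace ℂ H]
variable {K : Type*} [NormedAddCommGroup K] [InnerProductSpace ℂ K]
variable {ι κ : Type*}

theorem mem_of_basis {M : Type*} [NormedAddCommGroup M] [NormedSpace ℂ M]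
    (S : Submodule ℂ M) (hc : IsClosed (S : Set M)) (d : HilbertBasis ι ℂ H) (f : H →L[ℂ] M)
    (hf : ∀ i, f (d i) ∈ S) (x : H) : f x ∈ S :=
  hc.mem_of_tendsto (f.hasSum (d.hasSum_repr x)) (Filter.Eventually.of_forall fun s =>
    Submodule.sum_mem _ fun i _ => by
      simp only [map_smul]
      exact Submodule.smul_mem _ _ (hf i))

theorem orthonormal_vtmul (b : HilbertBasis ι ℂ H) (c : HilbertBasis κ ℂ K) :
    Orthonormal ℂ fun p : ι × κ => vtmul (b p.1) (c p.2) :=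
  (b.orthonormal.tmul c.orthonormal).comp_linearIsometry ofAlg

/-- The tensor product of two Hilbert bases. -/
def tensorBasis (b : HilbertBasis ι ℂ H) (c : HilbertBasis κ ℂ K) :
    HilbertBasis (ι × κ) ℂ (HilbertTensor H K) :=
  HilbertBasis.mk (orthonormal_vtmul b c) <| by
  set S := (Submodule.span ℂ
    (Set.range fun p : ι × κ => vtmul (b p.1) (c p.2))).topologicalClosure with hS
  have hc : IsClosed (S : Set (HilbertTensor H K)) := Submodule.isClosed_topologicalClosure _
  have h1 : ∀ i y, vtmul (b i) y ∈ S := fun i =>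
    mem_of_basis S hc c (ofAlg.toContinuousLinearMap ∘L TensorProduct.mkL ℂ H K (b i)) fun j =>
      Submodule.le_topologicalClosure _ (Submodule.subset_span ⟨(i, j), rfl⟩)
  have h2 : ∀ x y, vtmul x y ∈ S := by
    intro x y
    exact mem_of_basis S hc b (ofAlg.toContinuousLinearMap ∘L (TensorProduct.mkL ℂ H K).flip y)
      (fun i => h1 i y) x
  rw [← dense_span_vtmul (H := H) (K := K)]
  refine Submodule.topologicalClosure_minimal _ (Submodule.span_le.2 ?_) hc
  rintro v ⟨x, y, rfl⟩
  exact h2 x y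

theorem tensorBasis_apply (b : HilbertBasis ι ℂ H) (c : HilbertBasis κ ℂ K) (p : ι × κ) :
    tensorBasis b c p = vtmul (b p.1) (c p.2) := by
  rw [tensorBasis, HilbertBasis.coe_mk]

theorem clm_ext_basis {M : Type*} [NormedAddCommGroup M] [NormedSpace ℂ M]
    (b : HilbertBasis ι ℂ H) {f g : H →L[ℂ] M} (h : ∀ i, f (b i) = g (b i)) : f = g := by
  refine ContinuousLinearMap.ext_on (s := Set.range b) ?_ ?_
  · intro v
    exact b.dense_span.ge (Submodule.mem_top (x := v))
  · rintro v ⟨i, rfl⟩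
    exact h i

end Basis

/-- The Hilbert space `ℓ²(ℤ)`. -/
abbrev L2Z : Type := lp (fun _ : ℤ => ℂ) 2

/-- The standard Hilbert basis of `ℓ²(ℤ)`. -/
def fBasis : HilbertBasis ℤ ℂ L2Z := HilbertBasis.ofRepr (LinearIsometryEquiv.refl ℂ _)

/-- The bijection `(i, j) ↦ (min i j, i - j)`. -/
def diagEquiv : ℕ × ℕ ≃ ℕ × ℤ where
  toFun p := (min p.1 p.2, (p.1 : ℤ) - p.2)
  invFun q := (q.1 + q.2.toNat, q.1 + (-q.2).toNat)
  left_inv p := by ext <;> simp <;> omega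
  right_inv q := by ext <;> simp; omega

theorem diagEquiv_succ (i j : ℕ) :
    diagEquiv (i + 1, j + 1) = ((diagEquiv (i, j)).1 + 1, (diagEquiv (i, j)).2) := by
  ext <;> simp [diagEquiv]

/-- The Hilbert basis `e i ⊗ e j`, indexed by `(min i j, i - j)`. -/
def diagBasis : HilbertBasis (ℕ × ℤ) ℂ (HilbertTensor L2 L2) :=
  HilbertBasis.mk (v := tensorBasis eBasis eBasis ∘ diagEquiv.symm)
    ((tensorBasis eBasis eBasis).orthonormal.comp _ diagEquiv.symm.injective) <| by
  rw [diagEquiv.symm.surjective.range_comp, HilbertBasis.dense_span]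

theorem diagBasis_apply (i j : ℕ) : diagBasis (diagEquiv (i, j)) = vtmul (e i) (e j) := by
  rw [diagBasis, HilbertBasis.coe_mk, Function.comp_apply, Equiv.symm_apply_apply,
    tensorBasis_apply, eBasis_apply, eBasis_apply]

/-- The unitary `ℓ² ⊗ ℓ²(ℤ) → ℓ² ⊗ ℓ²` which identifies `T ⊗ 1` with `T ⊗ T`. -/
def diagUnitary : HilbertTensor L2 L2Z ≃ₗᵢ[ℂ] HilbertTensor L2 L2 :=
  (tensorBasis eBasis fBasis).repr.trans diagBasis.repr.symm

theorem diagUnitary_apply (q : ℕ × ℤ) :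
    diagUnitary (vtmul (e q.1) (fBasis q.2)) = diagBasis q := by
  classical
  rw [← eBasis_apply, ← tensorBasis_apply eBasis fBasis q, diagUnitary,
    LinearIsometryEquiv.trans_apply, HilbertBasis.repr_self, HilbertBasis.repr_symm_single]

/-- The *-homomorphism `A ↦ A ⊗ 1`. -/
def ampliation : (L2 →L[ℂ] L2) →⋆ₐ[ℂ] (HilbertTensor L2 L2Z →L[ℂ] HilbertTensor L2 L2Z) where
  toFun A := opTensor A 1
  map_one' := opTensor_one
  map_mul' A B := by
    have h := opTensor_mul A B (1 : L2Z →L[ℂ] L2Z) 1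
    rwa [mul_one] at h
  map_zero' := by
    have h := opTensor_smul_left 0 (0 : L2 →L[ℂ] L2) (1 : L2Z →L[ℂ] L2Z)
    rwa [zero_smul, zero_smul] at h
  map_add' A B := opTensor_add_left A B 1
  commutes' c := by
    rw [Algebra.algebraMap_eq_smul_one, Algebra.algebraMap_eq_smul_one, opTensor_smul_left,
      opTensor_one]
  map_star' A := by
    rw [opTensor_star, star_one]

/-- The *-homomorphism `A ↦ W (A ⊗ 1) W*` on all bounded operators, with `W` the unitary above. -/
def comulAux : (L2 →L[ℂ] L2) →⋆ₐ[ℂ] (HilbertTensor L2 L2 →L[ℂ] HilbertTensor L2 L2) :=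
  diagUnitary.conjStarAlgEquiv.toStarAlgHom.comp ampliation

theorem comulAux_shift : comulAux shift = opTensor shift shift := by
  refine clm_ext_basis diagBasis fun q => ?_
  obtain ⟨⟨i, j⟩, rfl⟩ := diagEquiv.surjective q
  have h : comulAux shift (diagBasis (diagEquiv (i, j)))
      = diagUnitary (opTensor shift 1 (diagUnitary.symm (diagBasis (diagEquiv (i, j))))) := rfl
  rw [h, ← diagUnitary_apply, LinearIsometryEquiv.symm_apply_apply, opTensor_vtmul, shift_e,
    diagUnitary_apply, diagBasis_apply, opTensor_vtmul, shift_e, shift_e, ← diagBasis_apply,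
    diagEquiv_succ, ← diagUnitary_apply]
  rfl

theorem continuous_starAlgHom {H K : Type*} [NormedAddCommGroup H] [InnerProductSpace ℂ H]
    [CompleteSpace H] [NormedAddCommGroup K] [InnerProductSpace ℂ K] [CompleteSpace K]
    {S : StarSubalgebra ℂ (H →L[ℂ] H)} {S' : StarSubalgebra ℂ (K →L[ℂ] K)}
    (hS : IsClosed (S : Set (H →L[ℂ] H))) (hS' : IsClosed (S' : Set (K →L[ℂ] K)))
    (f : S →⋆ₐ[ℂ] S') : Continuous f := by
  let _ : CStarAlgebra S := StarSubalgebra.cstarAlgebra S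
  let _ : CStarAlgebra S' := StarSubalgebra.cstarAlgebra S'
  exact AddMonoidHomClass.continuous_of_bound f 1 fun a => by
    rw [one_mul]
    exact NonUnitalStarAlgHom.norm_apply_le f a

theorem comulAux_mem (A : Toeplitz) :
    comulAux (A : L2 →L[ℂ] L2) ∈ minTensor Toeplitz Toeplitz := by
  have hcont : Continuous comulAux :=
    AddMonoidHomClass.continuous_of_bound comulAux 1 fun a => by
      rw [one_mul]
      exact NonUnitalStarAlgHom.norm_apply_le comulAux a
  have hle : Toeplitz ≤ (minTensor Toeplitz Toeplitz).comap comulAux := by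
    refine StarAlgebra.elemental.le_of_mem (isClosed_minTensor.preimage hcont) ?_
    rw [StarSubalgebra.mem_comap, comulAux_shift]
    exact (tmul T T).2
  exact hle A.2

/-- There is exactly one unital *-homomorphism from the Toeplitz algebra to its minimal tensor
square which maps `T` to `T ⊗ T`. -/
theorem existsUnique_comul :
    ∃! Δ : Toeplitz →⋆ₐ[ℂ] minTensor Toeplitz Toeplitz, Δ T = tmul T T := by
  refine ⟨(comulAux.comp Toeplitz.subtype).codRestrict _ comulAux_mem, ?_, fun Δ hΔ => ?_⟩
  · exact Subtype.ext comulAux_shift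
  · have hc : IsClosed (Toeplitz : Set (L2 →L[ℂ] L2)) := StarAlgebra.elemental.isClosed ℂ shift
    refine StarAlgebra.elemental.starAlgHomClass_ext ℂ
      (continuous_starAlgHom hc isClosed_minTensor _)
      (continuous_starAlgHom hc isClosed_minTensor _) ?_
    exact hΔ.trans (Subtype.ext comulAux_shift).symm

/-- The comultiplication `Δ` of the Toeplitz algebra: the unital *-homomorphism to the minimal
tensor square with `Δ(T) = T ⊗ T`. -/
def comul : Toeplitz →⋆ₐ[ℂ] minTensor Toeplitz Toeplitz := existsUnique_comul.choose

theorem comul_T : comul T = tmul T T := existsUnique_comul.choose_spec.1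

theorem continuous_comul : Continuous comul :=
  continuous_starAlgHom (StarAlgebra.elemental.isClosed ℂ shift) isClosed_minTensor comul

/-- The comultiplication as a bounded linear map. -/
def comulL : Toeplitz →L[ℂ] minTensor Toeplitz Toeplitz where
  toFun := comul
  map_add' := map_add comul
  map_smul' := map_smul comul
  cont := continuous_comul

/-! ### The dual algebra, states and Haar functionals -/

/-- The product `ρ ∗ φ = (ρ ⊗ φ) ∘ Δ` of bounded functionals on the Toeplitz algebra. -/
def conv (ρ φ : StrongDual ℂ Toeplitz) : StrongDual ℂ Toeplitz :=
  (tensorFunctional ρ φ).comp comulL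

/-- A state: a positive linear functional of norm one. -/
def IsState (h : StrongDual ℂ Toeplitz) : Prop :=
  (∀ A : Toeplitz, 0 ≤ h (star A * A)) ∧ ‖h‖ = 1

/-- A Haar functional: a state `h` such that for each bounded functional `ρ` both products
`h ∗ ρ` and `ρ ∗ h` are equal to one and the same scalar multiple of `h`. -/
def IsHaar (h : StrongDual ℂ Toeplitz) : Prop :=
  IsState h ∧ ∀ ρ : StrongDual ℂ Toeplitz, ∃ c : ℂ, conv h ρ = c • h ∧ conv ρ h = c • h

end QSemigroup

end

/-!
The operators `T_{n,m}` span a dense subspace, because `T* T = 1`, and they are group-like: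
`Δ(T_{n,m}) = T_{n,m} ⊗ T_{n,m}`. Hence on them the convolution of functionals is pointwise
multiplication, which makes it commutative. The vacuum state takes the value `1` at `T_{0,0} = 1`
and vanishes at all the other `T_{n,m}`, so `vacuum ∗ ρ = ρ(1) vacuum` for each `ρ`. If `h(1) = 1`
and `h ∗ vacuum = c h`, then `vacuum = c h`, and evaluation at `1` gives `c = 1`. A state has
`h(1) = ‖h‖ = 1`.
-/

noncomputable section

namespace QSemigroup

section PositiveFunctional

variable {S : Type*} [CStarAlgebra S]

/- In the GNS space of `f` one has `f a = ⟪1, a · 1⟫` and `‖1‖ ^ 2 = f 1`, and left multiplication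
by `a` has norm at most `‖a‖`. -/
theorem norm_apply_le_of_positiveLinearMap [PartialOrder S] [StarOrderedRing S] (f : S →ₚ[ℂ] ℂ)
    (a : S) : ‖f a‖ ≤ ‖f 1‖ * ‖a‖ := by
  set Ω : f.PreGNS := f.toPreGNS 1
  have norm_Ω : ‖f 1‖ = ‖Ω‖ ^ 2 := by
    have := f.preGNS_norm_sq Ω
    rw [f.ofPreGNS_toPreGNS, star_one, one_mul] at this
    rw [← this, norm_pow, Complex.norm_real, norm_norm]
  have apply_eq_inner : f a = inner ℂ Ω (f.leftMulMapPreGNS a Ω) := by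
    simp [Ω, f.preGNS_inner_def]
  calc ‖f a‖ ≤ ‖Ω‖ * ‖f.leftMulMapPreGNS a Ω‖ := apply_eq_inner ▸ norm_inner_le_norm _ _
    _ ≤ ‖Ω‖ * (‖a‖ * ‖Ω‖) := by
        gcongr
        exact ContinuousLinearMap.le_of_opNorm_le _
          (LinearMap.mkContinuous_norm_le _ (norm_nonneg a) _) Ω
    _ = ‖f 1‖ * ‖a‖ := by rw [norm_Ω]; ring

theorem apply_one_eq_norm_of_positive {h : StrongDual ℂ S} (hpos : ∀ a, 0 ≤ h (star a * a)) :
    h 1 = ‖h‖ := by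
  let _ : PartialOrder S := CStarAlgebra.spectralOrder S
  have _ : StarOrderedRing S := CStarAlgebra.spectralOrderedRing S
  let f : S →ₚ[ℂ] ℂ := PositiveLinearMap.mk₀ h.toLinearMap fun a ha => by
    obtain ⟨b, rfl⟩ := CStarAlgebra.nonneg_iff_eq_star_mul_self.1 ha
    exact hpos b
  have norm_one_le : ‖(1 : S)‖ ≤ 1 := by
    nontriviality S
    exact CStarRing.norm_one.le
  have norm_eq : ‖h‖ = ‖h 1‖ := le_antisymm
    (h.opNorm_le_bound (norm_nonneg _) (norm_apply_le_of_positiveLinearMap f))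
    (h.unit_le_opNorm 1 norm_one_le)
  have one_nonneg : 0 ≤ h 1 := by simpa using hpos 1
  rw [norm_eq, Complex.norm_of_nonneg' one_nonneg]

end PositiveFunctional

section VectorFunctional

variable {H : Type*} [NormedAddCommGroup H] [InnerProductSpace ℂ H] [CompleteSpace H]

/-- The vector functional `A ↦ ⟪x, A x⟫` of an algebra of operators; for a unit vector `x` it is
the vector state of `x`. -/
def vectorFunctional (𝒜 : StarSubalgebra ℂ (H →L[ℂ] H)) (x : H) : StrongDual ℂ 𝒜 :=
  (coeff 𝒜 x x).mkContinuous (‖x‖ ^ 2) fun A => calc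
    ‖inner ℂ x ((A : H →L[ℂ] H) x)‖ ≤ ‖x‖ * (‖A‖ * ‖x‖) :=
      (norm_inner_le_norm _ _).trans (by gcongr; exact (A : H →L[ℂ] H).le_opNorm x)
    _ = ‖x‖ ^ 2 * ‖A‖ := by ring

variable (𝒜 : StarSubalgebra ℂ (H →L[ℂ] H)) (x : H)

theorem vectorFunctional_apply (A : 𝒜) :
    vectorFunctional 𝒜 x A = inner ℂ x ((A : H →L[ℂ] H) x) := rfl

theorem vectorFunctional_star_mul_self_nonneg (A : 𝒜) :
    0 ≤ vectorFunctional 𝒜 x (star A * A) := by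
  have : vectorFunctional 𝒜 x (star A * A)
      = inner ℂ ((A : H →L[ℂ] H) x) ((A : H →L[ℂ] H) x) :=
    ContinuousLinearMap.adjoint_inner_right (A : H →L[ℂ] H) x ((A : H →L[ℂ] H) x)
  rw [this, inner_self_eq_norm_sq_to_K]
  exact pow_nonneg (Complex.zero_le_real.2 (norm_nonneg ((A : H →L[ℂ] H) x))) 2

theorem norm_vectorFunctional : ‖vectorFunctional 𝒜 x‖ = ‖x‖ ^ 2 := by
  refine le_antisymm (LinearMap.mkContinuous_norm_le _ (by positivity) _) ?_
  have norm_apply_one : ‖vectorFunctional 𝒜 x 1‖ = ‖x‖ ^ 2 := by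
    rw [vectorFunctional_apply, OneMemClass.coe_one, one_apply_eq_self,
      inner_self_eq_norm_sq_to_K, norm_pow, RCLike.norm_ofReal, abs_norm]
  rw [← norm_apply_one]
  have norm_one_le : ‖(1 : 𝒜)‖ ≤ 1 := ContinuousLinearMap.norm_id_le (𝕜 := ℂ) (E := H)
  exact (vectorFunctional 𝒜 x).unit_le_opNorm 1 norm_one_le

end VectorFunctional

section Isometry

theorem pow_mul_pow_mul_pow_mul_pow_of_mul_eq_one {M : Type*} [Monoid M] {a b : M} (h : b * a = 1)
    (n m k l : ℕ) :
    a ^ n * b ^ m * (a ^ k * b ^ l) = a ^ (n + (k - m)) * b ^ (m - k + l) := by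
  rcases le_total m k with hmk | hkm
  · obtain ⟨j, rfl⟩ := Nat.exists_eq_add_of_le hmk
    calc a ^ n * b ^ m * (a ^ (m + j) * b ^ l) = a ^ n * (b ^ m * a ^ m) * a ^ j * b ^ l := by
          simp only [pow_add, mul_assoc]
      _ = a ^ (n + (m + j - m)) * b ^ (m - (m + j) + l) := by
          simp [pow_mul_pow_eq_one m h, pow_add]
  · obtain ⟨j, rfl⟩ := Nat.exists_eq_add_of_le' hkm
    calc a ^ n * b ^ (j + k) * (a ^ k * b ^ l) = a ^ n * b ^ j * (b ^ k * a ^ k) * b ^ l := by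
          simp only [pow_add, mul_assoc]
      _ = a ^ (n + (k - (j + k))) * b ^ (j + k - k + l) := by
          simp [pow_mul_pow_eq_one k h, pow_add, mul_assoc]

theorem adjoin_singleton_eq_span_of_star_mul_self {R B : Type*} [CommSemiring R] [StarRing R]
    [Semiring B] [StarRing B] [Algebra R B] [StarModule R B] {v : B} (hv : star v * v = 1) :
    (StarAlgebra.adjoin R {v}).toSubalgebra.toSubmodule
      = Submodule.span R (Set.range fun p : ℕ × ℕ => v ^ p.1 * star v ^ p.2) := by
  let N : Submonoid B :=
    { carrier := Set.range fun p : ℕ × ℕ => v ^ p.1 * star v ^ p.2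
      one_mem' := ⟨(0, 0), by simp⟩
      mul_mem' := by
        rintro _ _ ⟨⟨n, m⟩, rfl⟩ ⟨⟨k, l⟩, rfl⟩
        exact ⟨(n + (k - m), m - k + l),
          (pow_mul_pow_mul_pow_mul_pow_of_mul_eq_one hv n m k l).symm⟩ }
  have closure_eq : Submonoid.closure ({v} ∪ star {v}) = N := by
    refine Submonoid.closure_eq_of_le ?_ ?_
    · rintro w (rfl | hw)
      · exact ⟨(1, 0), by simp⟩
      · exact ⟨(0, 1), by simp [← Set.mem_singleton_iff.1 hw]⟩
    · rintro _ ⟨⟨n, m⟩, rfl⟩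
      exact mul_mem (pow_mem (Submonoid.subset_closure (by simp)) n)
        (pow_mem (Submonoid.subset_closure (by simp)) m)
  rw [StarAlgebra.adjoin_eq_span, closure_eq]
  rfl

end Isometry

section TensorProduct

variable {H : Type*} [NormedAddCommGroup H] [InnerProductSpace ℂ H] [CompleteSpace H]
variable {K : Type*} [NormedAddCommGroup K] [InnerProductSpace ℂ K] [CompleteSpace K]
variable {𝒜 : StarSubalgebra ℂ (H →L[ℂ] H)} {ℬ : StarSubalgebra ℂ (K →L[ℂ] K)}

theorem tmul_mul_tmul (A C : 𝒜) (B D : ℬ) : tmul A B * tmul C D = tmul (A * C) (B * D) :=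
  Subtype.ext (opTensor_mul _ _ _ _).symm

theorem one_tmul_one : tmul (1 : 𝒜) (1 : ℬ) = 1 :=
  Subtype.ext opTensor_one

theorem star_tmul (A : 𝒜) (B : ℬ) : star (tmul A B) = tmul (star A) (star B) :=
  Subtype.ext (opTensor_star _ _)

theorem tmul_pow (A : 𝒜) (B : ℬ) (n : ℕ) : tmul A B ^ n = tmul (A ^ n) (B ^ n) := by
  induction n with
  | zero => simp only [pow_zero, one_tmul_one]
  | succ n ih => rw [pow_succ, ih, tmul_mul_tmul, ← pow_succ, ← pow_succ]

end TensorProduct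

section Toeplitz

theorem isClosed_toeplitz : IsClosed (Toeplitz : Set (L2 →L[ℂ] L2)) :=
  StarAlgebra.elemental.isClosed ℂ shift

theorem star_shift_mul_shift : star shift * shift = 1 :=
  (ContinuousLinearMap.norm_map_iff_adjoint_comp_self shift).1 shiftIsometry.norm_map

theorem Tnm_zero_zero : Tnm 0 0 = 1 := by
  rw [Tnm, pow_zero, pow_zero, one_mul]

theorem dense_span_range_Tnm :
    Dense (Submodule.span ℂ (Set.range fun p : ℕ × ℕ => Tnm p.1 p.2) : Set Toeplitz) := by
  have map_span : (Submodule.span ℂ (Set.range fun p : ℕ × ℕ => Tnm p.1 p.2)).map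
      Toeplitz.subtype.toAlgHom.toLinearMap
      = (StarAlgebra.adjoin ℂ {shift}).toSubalgebra.toSubmodule := by
    rw [adjoin_singleton_eq_span_of_star_mul_self star_shift_mul_shift, Submodule.map_span,
      ← Set.range_comp]
    rfl
  have image_span : Subtype.val ''
      (Submodule.span ℂ (Set.range fun p : ℕ × ℕ => Tnm p.1 p.2) : Set Toeplitz)
      = (StarAlgebra.adjoin ℂ {shift} : Set (L2 →L[ℂ] L2)) := congrArg SetLike.coe map_span
  intro A
  rw [closure_subtype, image_span]
  exact A.2

theorem strongDual_ext_Tnm {f g : StrongDual ℂ Toeplitz}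
    (h : ∀ n m, f (Tnm n m) = g (Tnm n m)) : f = g :=
  ContinuousLinearMap.ext_on dense_span_range_Tnm (Set.forall_mem_range.2 fun p => h p.1 p.2)

theorem comul_Tnm (n m : ℕ) : comul (Tnm n m) = tmul (Tnm n m) (Tnm n m) := by
  rw [Tnm, map_mul, map_pow, map_pow, map_star, comul_T, star_tmul, tmul_pow, tmul_pow,
    tmul_mul_tmul]

theorem conv_apply_Tnm (ρ φ : StrongDual ℂ Toeplitz) (n m : ℕ) :
    conv ρ φ (Tnm n m) = ρ (Tnm n m) * φ (Tnm n m) :=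
  (congrArg (tensorFunctional ρ φ) (comul_Tnm n m)).trans (tensorFunctional_tmul _ _ _ _)

theorem conv_comm (ρ φ : StrongDual ℂ Toeplitz) : conv ρ φ = conv φ ρ :=
  strongDual_ext_Tnm fun n m => by rw [conv_apply_Tnm, conv_apply_Tnm, mul_comm]

theorem IsState.apply_one {h : StrongDual ℂ Toeplitz} (hh : IsState h) : h 1 = 1 := by
  let _ : CStarAlgebra Toeplitz :=
    StarSubalgebra.cstarAlgebra (h_closed := isClosed_toeplitz) Toeplitz
  rw [apply_one_eq_norm_of_positive hh.1, hh.2, Complex.ofReal_one]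

end Toeplitz

section Vacuum

theorem norm_e (n : ℕ) : ‖e n‖ = 1 := by
  rw [e, lp.norm_single (by norm_num), norm_one]

theorem star_shift_e_zero : star shift (e 0) = 0 := by
  refine ext_inner_right ℂ fun x => ?_
  calc inner ℂ (star shift (e 0)) x = inner ℂ (e 0) (shift x) :=
        ContinuousLinearMap.adjoint_inner_left shift x (e 0)
    _ = inner ℂ 1 (shiftFun x 0) := lp.inner_single_left 0 1 (shift x)
    _ = inner ℂ (0 : L2) x := by rw [shiftFun, inner_zero_right, inner_zero_left]

theorem star_shift_pow_e_zero (m : ℕ) : (star shift ^ m) (e 0) = if m = 0 then e 0 else 0 := by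
  cases m with
  | zero => rfl
  | succ k => simp [pow_succ, star_shift_e_zero]

/-- The vector state `A ↦ ⟪e 0, A (e 0)⟫` of the Toeplitz algebra. -/
def vacuum : StrongDual ℂ Toeplitz := vectorFunctional Toeplitz (e 0)

theorem isState_vacuum : IsState vacuum :=
  ⟨vectorFunctional_star_mul_self_nonneg Toeplitz (e 0), by
    rw [vacuum, norm_vectorFunctional, norm_e, one_pow]⟩

theorem vacuum_Tnm (n m : ℕ) : vacuum (Tnm n m) = if n = 0 ∧ m = 0 then 1 else 0 := by
  have apply_eq_inner :
      vacuum (Tnm n m) = inner ℂ ((star shift ^ n) (e 0)) ((star shift ^ m) (e 0)) := by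
    rw [← star_pow shift n, ContinuousLinearMap.star_eq_adjoint (shift ^ n),
      ContinuousLinearMap.adjoint_inner_left]
    rfl
  rw [apply_eq_inner, star_shift_pow_e_zero, star_shift_pow_e_zero]
  rcases eq_or_ne n 0 with rfl | hn <;> rcases eq_or_ne m 0 with rfl | hm <;>
    simp [inner_self_eq_norm_sq_to_K, norm_e, *]

theorem conv_vacuum_left (ρ : StrongDual ℂ Toeplitz) : conv vacuum ρ = ρ 1 • vacuum :=
  strongDual_ext_Tnm fun n m => by
    rw [conv_apply_Tnm, smul_apply, vacuum_Tnm, smul_eq_mul]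
    split_ifs with hnm
    · rw [hnm.1, hnm.2, Tnm_zero_zero, mul_comm]
    · rw [zero_mul, mul_zero]

theorem isHaar_vacuum : IsHaar vacuum :=
  ⟨isState_vacuum, fun ρ =>
    ⟨ρ 1, conv_vacuum_left ρ, (conv_comm ρ vacuum).trans (conv_vacuum_left ρ)⟩⟩

theorem eq_vacuum_of_conv_vacuum_eq_smul {h : StrongDual ℂ Toeplitz} (h_one : h 1 = 1) {c : ℂ}
    (hc : conv h vacuum = c • h) : h = vacuum := by
  have smul_eq : vacuum = c • h := by
    rw [← hc, conv_comm, conv_vacuum_left, h_one, one_smul]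
  have c_eq_one : c = 1 := by
    simpa [h_one, isState_vacuum.apply_one] using (DFunLike.congr_fun smul_eq 1).symm
  rw [smul_eq, c_eq_one, one_smul]

end Vacuum

end QSemigroup

end

open QSemigroup in
theorem theorem8_general (h : StrongDual ℂ Toeplitz) :
    [IsHaar h,
      h 1 = 1 ∧ ∀ ρ : StrongDual ℂ Toeplitz, ∃ c : ℂ, conv h ρ = c • h,
      ∀ n m : ℕ, h (Tnm n m) = if n = 0 ∧ m = 0 then 1 else 0,
      ∀ A : Toeplitz, h A = inner ℂ (e 0) ((A : L2 →L[ℂ] L2) (e 0))].TFAE := by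
  tfae_have 1 → 2 := fun hh => ⟨hh.1.apply_one, fun ρ => (hh.2 ρ).imp fun _ => And.left⟩
  tfae_have 2 → 4 := fun ⟨h_one, h_conv⟩ A => by
    obtain ⟨c, hc⟩ := h_conv vacuum
    rw [eq_vacuum_of_conv_vacuum_eq_smul h_one hc]
    rfl
  tfae_have 4 → 3 := fun hA n m => (hA (Tnm n m)).trans (vacuum_Tnm n m)
  tfae_have 3 → 1 := fun hT =>
    strongDual_ext_Tnm (fun n m => (hT n m).trans (vacuum_Tnm n m).symm) ▸ isHaar_vacuum
  tfae_finish

theorem theorem8 :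
    (∀ h : StrongDual ℂ QSemigroup.Toeplitz, QSemigroup.IsState h →
      (QSemigroup.IsHaar h ↔
        ∀ n m : ℕ, h (QSemigroup.Tnm n m) = if n = 0 ∧ m = 0 then 1 else 0)) ∧
    (∃ h : StrongDual ℂ QSemigroup.Toeplitz, QSemigroup.IsHaar h) ∧
    (∀ h : StrongDual ℂ QSemigroup.Toeplitz, QSemigroup.IsHaar h →
      ∀ A : QSemigroup.Toeplitz,
        h A = inner ℂ (QSemigroup.e 0)
          ((A : QSemigroup.L2 →L[ℂ] QSemigroup.L2) (QSemigroup.e 0))) :=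
  ⟨fun h _ => (theorem8_general h).out 0 2, ⟨QSemigroup.vacuum, QSemigroup.isHaar_vacuum⟩,
    fun h => ((theorem8_general h).out 0 3).1⟩
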